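/- Let $Q_n$ be the $n$-dimensional hypercube: its vertices are the binary strings of length $n$, and two strings are adjacent if and only if they differ in exactly one position. Let $K_{1,r}$ be the star with $r$ leaves. For a set $F$ of subgraphs of a graph $G$, let $G-F$ be the graph obtained from $G$ by deleting all vertices of all members of $F$. For a connected graph $T$, the $T$-structure connectivity $\kappa(G;T)$ (respectively, the $T$-substructure connectivity $\kappa^s(G;T)$) is the minimum cardinality of a set $F$ of subgraphs of $G$, each isomorphic to $T$ (respectively, each isomorphic to a connected subgraph of $T$), such that $G-F$ is disconnected, i.e. has more than one component. For integers $r\ge 2$ put $$f(r)=\begin{cases}\max\left\{\dfrac{r+7}{2},\ \dfrac{r^2+4r+3}{8}\right\}, & r \text{ odd},\\[2ex] \max\left\{\dfrac{r^2+2r}{8},\ \dfrac{r+8}{2},\ \dfrac{r^2+6r+12}{12}\right\}, & r \text{ even}.\end{cases}$$ Theorem. If $r\ge 2$ and $n$ are integers with $n>f(r)$, then $$\kappa(Q_n;K_{1,r})=\kappa^s(Q_n;K_{1,r})=\left\lceil \frac n2\right\rceil .$$ -/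

import Mathlib

/-- The `n`-dimensional hypercube `Q_n`: the vertices are the binary strings of length `n`, two of
them being adjacent iff they differ in exactly one position. -/
def hypercube (n : ℕ) : SimpleGraph (Fin n → Bool) where
  Adj u v := hammingDist u v = 1
  symm := ⟨fun u v h => by rw [hammingDist_comm]; exact h⟩
  loopless := ⟨fun u h => by simp at h⟩

/-- The star `K_{1,r}` with `r` leaves. -/
def completeStar (r : ℕ) : SimpleGraph (Fin 1 ⊕ Fin r) :=
  completeBipartiteGraph (Fin 1) (Fin r)

/-- The graph `G - F`: all vertices of all members of `F` are deleted from `G`. -/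
def deleteFamily {V : Type*} (G : SimpleGraph V) (F : Set G.Subgraph) :
    SimpleGraph {v : V // v ∉ ⋃ H ∈ F, H.verts} :=
  G.comap Subtype.val

/-- A graph is disconnected if it has more than one component, i.e. two of its vertices are not
joined by a walk. The graph without vertices is not disconnected. -/
def IsDisconnected {V : Type*} (G : SimpleGraph V) : Prop :=
  ¬ G.Preconnected

/-- `F` is a `T`-structure-cut of `G`: every member of `F` is isomorphic to `T`, and `G - F` is
disconnected. -/
def IsStructureCut {V W : Type*} (G : SimpleGraph V) (T : SimpleGraph W)
    (F : Set G.Subgraph) : Prop :=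
  (∀ H ∈ F, Nonempty (H.coe ≃g T)) ∧ IsDisconnected (deleteFamily G F)

/-- `F` is a `T`-substructure-cut of `G`: every member of `F` is isomorphic to a connected
subgraph of `T`, and `G - F` is disconnected. -/
def IsSubstructureCut {V W : Type*} (G : SimpleGraph V) (T : SimpleGraph W)
    (F : Set G.Subgraph) : Prop :=
  (∀ H ∈ F, ∃ T' : T.Subgraph, T'.Connected ∧ Nonempty (H.coe ≃g T'.coe)) ∧
    IsDisconnected (deleteFamily G F)

/-- The `T`-structure connectivity `κ(G, T)`: the minimum cardinality of a `T`-structure-cut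
of `G` (`⊤` if there is no such cut). -/
noncomputable def structureConnectivity {V W : Type*} (G : SimpleGraph V) (T : SimpleGraph W) :
    ℕ∞ :=
  sInf {c | ∃ F : Set G.Subgraph, IsStructureCut G T F ∧ F.encard = c}

/-- The `T`-substructure connectivity `κˢ(G, T)`: the minimum cardinality of a
`T`-substructure-cut of `G` (`⊤` if there is no such cut). -/
noncomputable def substructureConnectivity {V W : Type*} (G : SimpleGraph V)
    (T : SimpleGraph W) : ℕ∞ :=
  sInf {c | ∃ F : Set G.Subgraph, IsSubstructureCut G T F ∧ F.encard = c}

/-- The threshold function `f(r)`, used for integers `r ≥ 2` only. -/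
def starThreshold (r : ℕ) : ℚ :=
  if Odd r then
    max (((r : ℚ) + 7) / 2) (((r : ℚ) ^ 2 + 4 * r + 3) / 8)
  else
    max (((r : ℚ) ^ 2 + 2 * r) / 8) (max (((r : ℚ) + 8) / 2) (((r : ℚ) ^ 2 + 6 * r + 12) / 12))

/-! Upper bound: pair up the coordinates and, for each pair `p`, `q`, delete a star centred at the
string with ones exactly at `p` and `q`, two of whose leaves are the unit strings of `p` and `q`.
These ⌈n/2⌉ stars remove every neighbour of the zero string but not that string itself.

Lower bound, for substructures and hence for both invariants: every deleted piece contains a centre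
adjacent to the rest of it. Give each star weight 2 and each single vertex weight 1;
`hypercubeDelete_preconnected` shows by induction on n that a total weight below n cannot disconnect
Q_n. Split along a coordinate separating two of the centres and single vertices. A star centred in
one half meets the other in at most one vertex, so it counts there with weight 1 only, and each half
sees a strictly smaller total. By counting, some edge between the halves survives.

The threshold enters only through r ≤ n and 4 ≤ n. -/

/-! ### Coordinate flips and Hamming distance -/

/-- The string obtained from `v` by switching its `i`-th entry. -/
def flipAt {n : ℕ} (v : Fin n → Bool) (i : Fin n) : Fin n → Bool :=
  Function.update v i (!v i)

@[simp]
theorem flipAt_same {n : ℕ} (v : Fin n → Bool) (i : Fin n) : flipAt v i i = !v i := by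
  simp [flipAt]

theorem flipAt_of_ne {n : ℕ} (v : Fin n → Bool) {i j : Fin n} (h : j ≠ i) :
    flipAt v i j = v j := by
  simp [flipAt, h]

theorem flipAt_injective {n : ℕ} (v : Fin n → Bool) : Function.Injective (flipAt v) := by
  intro i j h
  by_contra hij
  have := congrFun h i
  simp [flipAt_of_ne v hij] at this

theorem flipAt_comm {n : ℕ} (v : Fin n → Bool) {i j : Fin n} (h : i ≠ j) :
    flipAt (flipAt v i) j = flipAt (flipAt v j) i := by
  simp only [flipAt, Function.update_of_ne h, Function.update_of_ne h.symm]
  exact Function.update_comm h _ _ _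

@[simp]
theorem flipAt_flipAt {n : ℕ} (v : Fin n → Bool) (i : Fin n) : flipAt (flipAt v i) i = v := by
  simp [flipAt]

theorem hammingDist_flipAt {n : ℕ} {c v : Fin n → Bool} {i : Fin n} (h : v i = c i) :
    hammingDist c (flipAt v i) = hammingDist c v + 1 := by
  have : (Finset.univ.filter fun j => c j ≠ flipAt v i j) =
      insert i (Finset.univ.filter fun j => c j ≠ v j) := by
    ext j
    by_cases hj : j = i
    · subst hj
      simp [h]
    · simp [hj, flipAt_of_ne v hj]
  rw [hammingDist, this, Finset.card_insert_of_notMem (by simp [h]), hammingDist]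

theorem hypercube_adj_flipAt {n : ℕ} (v : Fin n → Bool) (i : Fin n) :
    (hypercube n).Adj v (flipAt v i) := by
  change hammingDist v _ = 1
  simp [hammingDist_flipAt (c := v) (v := v) rfl]

theorem hypercube_adj_iff_exists_flipAt {n : ℕ} {u v : Fin n → Bool} :
    (hypercube n).Adj u v ↔ ∃ i, v = flipAt u i := by
  refine ⟨fun h => ?_, ?_⟩
  · obtain ⟨i, hi⟩ := Finset.card_eq_one.mp (show (Finset.univ.filter fun j => u j ≠ v j).card = 1
      from h)
    have hmem (j : Fin n) : u j ≠ v j ↔ j = i := by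
      simpa using Finset.ext_iff.mp hi j
    refine ⟨i, funext fun j => ?_⟩
    by_cases hj : j = i
    · subst hj
      have := (hmem j).mpr rfl
      rw [flipAt_same]
      cases hu : u j <;> cases hv : v j <;> simp_all
    · rw [flipAt_of_ne u hj]
      exact (not_not.mp (mt (hmem j).mp hj)).symm
  · rintro ⟨i, rfl⟩
    exact hypercube_adj_flipAt u i

theorem hammingDist_insertNth {n : ℕ} (i : Fin (n + 1)) (b b' : Bool) (x y : Fin n → Bool) :
    hammingDist (i.insertNth b x : Fin (n + 1) → Bool) (i.insertNth b' y) =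
      (if b = b' then 0 else 1) + hammingDist x y := by
  simp only [hammingDist, Finset.card_filter, Fin.sum_univ_succAbove _ i,
    Fin.insertNth_apply_same, Fin.insertNth_apply_succAbove]
  congr 1
  split_ifs <;> simp_all

theorem card_hammingDist_le_one {n : ℕ} (c : Fin n → Bool) :
    (Finset.univ.filter fun v => hammingDist c v ≤ 1).card ≤ n + 1 := by
  have hsub : (Finset.univ.filter fun v => hammingDist c v ≤ 1) ⊆
      insert c (Finset.univ.image (flipAt c)) := by
    intro v hv
    have hv : hammingDist c v ≤ 1 := by simpa using hv
    rcases Nat.lt_or_ge (hammingDist c v) 1 with h | h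
    · simp [hammingDist_lt_one.mp h]
    · obtain ⟨i, rfl⟩ := hypercube_adj_iff_exists_flipAt.mp (le_antisymm hv h)
      simp
  calc _ ≤ _ := Finset.card_le_card hsub
    _ ≤ _ := Finset.card_insert_le _ _
    _ ≤ n + 1 := by
      have := Finset.card_image_le (s := Finset.univ) (f := flipAt c)
      simp only [Finset.card_univ, Fintype.card_fin] at this
      omega

/-! ### Connectedness after deleting few stars and vertices -/

/-- The graph `Q_n - S`. -/
abbrev hypercubeDelete {n : ℕ} (S : Set (Fin n → Bool)) : SimpleGraph {v // v ∉ S} :=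
  (hypercube n).comap Subtype.val

/-- Deleting a vertex together with some of its neighbours leaves the hypercube connected: all
other vertices are joined to the antipode. -/
theorem hypercubeDelete_preconnected_of_subset_ball {n : ℕ} {S : Set (Fin n → Bool)}
    (c : Fin n → Bool) (hball : ∀ v ∈ S, hammingDist c v ≤ 1) (hc : ∀ v ∈ S, c ∈ S) :
    (hypercubeDelete S).Preconnected := by
  -- Moving away from `c` never enters `S`: otherwise the previous vertex would be `c`, itself
  -- deleted.
  have step (v : Fin n → Bool) (hv : v ∉ S) (i : Fin n) (hi : v i = c i) : flipAt v i ∉ S := by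
    intro hw
    have h1 := hball _ hw
    rw [hammingDist_flipAt hi] at h1
    have h2 : c = v := hammingDist_lt_one.mp (by omega)
    exact hv (h2 ▸ hc _ hw)
  have reach : ∀ k (u : {v // v ∉ S}), n ≤ hammingDist c u.1 + k →
      ∃ h : (fun j => !c j) ∉ S, (hypercubeDelete S).Reachable u ⟨_, h⟩ := by
    intro k
    induction k with
    | zero =>
      intro u hu
      have : u.1 = fun j => !c j := by
        by_contra hne
        obtain ⟨i, hi⟩ := Function.ne_iff.mp hne
        have h1 := hammingDist_flipAt (c := c) (v := u.1) (i := i) (by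
          cases h : u.1 i <;> cases h' : c i <;> simp_all)
        have h2 := hammingDist_le_card_fintype (x := c) (y := flipAt u.1 i)
        simp only [Fintype.card_fin] at h2
        omega
      obtain ⟨u, hu'⟩ := u
      subst this
      exact ⟨hu', SimpleGraph.Reachable.refl _⟩
    | succ k ih =>
      intro u hu
      by_cases hne : u.1 = fun j => !c j
      · obtain ⟨u, hu'⟩ := u
        subst hne
        exact ⟨hu', SimpleGraph.Reachable.refl _⟩
      · obtain ⟨i, hi⟩ := Function.ne_iff.mp hne
        have hi : u.1 i = c i := by
          cases h : u.1 i <;> cases h' : c i <;> simp_all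
        obtain ⟨h, hr⟩ := ih ⟨flipAt u.1 i, step _ u.2 i hi⟩ (by
          change n ≤ hammingDist c (flipAt u.1 i) + k
          rw [hammingDist_flipAt hi]
          omega)
        refine ⟨h, SimpleGraph.Reachable.trans (SimpleGraph.Adj.reachable ?_) hr⟩
        exact hypercube_adj_flipAt u.1 i
  intro u v
  obtain ⟨h, hr⟩ := reach n u (by omega)
  obtain ⟨_, hr'⟩ := reach n v (by omega)
  exact hr.trans hr'.symm

theorem mul_succ_lt_two_pow_succ (n : ℕ) : n * (n + 1) < 2 ^ (n + 1) := by
  induction n with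
  | zero => simp
  | succ n ih =>
    have h := Nat.lt_two_pow_self (n := n)
    have h2 := pow_succ 2 (n + 1)
    have h3 := pow_succ 2 n
    have h4 : (n + 1) * (n + 1 + 1) = n * (n + 1) + 2 * (n + 1) := by ring
    omega

/-- If the two halves of a hypercube stay connected and some edge between them survives, then the
whole hypercube stays connected. -/
theorem hypercubeDelete_preconnected_of_halves {n : ℕ} {S : Set (Fin (n + 1) → Bool)}
    (i : Fin (n + 1))
    (hhalf : ∀ b : Bool, (hypercubeDelete {x : Fin n → Bool | i.insertNth b x ∈ S}).Preconnected)
    (hcross : ∃ x : Fin n → Bool, ∀ b : Bool, i.insertNth b x ∉ S) :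
    (hypercubeDelete S).Preconnected := by
  obtain ⟨x, hx⟩ := hcross
  have hin (b : Bool) (u : Fin n → Bool) (hu : i.insertNth b u ∉ S) :
      (hypercubeDelete S).Reachable ⟨i.insertNth b u, hu⟩ ⟨i.insertNth b x, hx b⟩ := by
    let φ : hypercubeDelete {x : Fin n → Bool | i.insertNth b x ∈ S} →g hypercubeDelete S :=
      { toFun := fun v => ⟨i.insertNth b v.1, v.2⟩
        map_rel' := by
          intro a a' h
          change hammingDist _ _ = 1
          rw [hammingDist_insertNth]
          rw [if_pos rfl, zero_add]
          exact h }
    exact (hhalf b ⟨u, hu⟩ ⟨x, hx b⟩).map φ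
  have hbase (b b' : Bool) :
      (hypercubeDelete S).Reachable ⟨i.insertNth b x, hx b⟩ ⟨i.insertNth b' x, hx b'⟩ := by
    by_cases h : b = b'
    · subst h
      exact SimpleGraph.Reachable.refl _
    · refine SimpleGraph.Adj.reachable ?_
      change hammingDist _ _ = 1
      simp [hammingDist_insertNth, h]
  have hall (u : {v // v ∉ S}) :
      (hypercubeDelete S).Reachable u ⟨i.insertNth (u.1 i) x, hx _⟩ := by
    obtain ⟨u, hu⟩ := u
    have := hin (u i) (i.removeNth u) (by rwa [Fin.insertNth_self_removeNth])
    simpa only [Fin.insertNth_self_removeNth] using this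
  exact fun u v => ((hall u).trans (hbase _ _)).trans (hall v).symm

/-- The number of strings in `A` with prescribed `i`-th entry. -/
theorem card_filter_insertNth_mem {n : ℕ} (A : Finset (Fin (n + 1) → Bool)) (i : Fin (n + 1))
    (b : Bool) :
    (Finset.univ.filter fun x : Fin n → Bool => i.insertNth b x ∈ A).card =
      (A.filter fun v => v i = b).card := by
  refine Finset.card_bij (fun x _ => i.insertNth b x) ?_ ?_ ?_
  · intro x hx
    simpa using hx
  · intro x _ y _ h
    exact Fin.insertNth_right_injective (α := fun _ => Bool) b h
  · intro v hv
    obtain ⟨hv, rfl⟩ := Finset.mem_filter.mp hv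
    exact ⟨i.removeNth v, by simpa using hv, by simp⟩

/-- Deleting `A.card` stars (with centres in `A`) and `B.card` single vertices from `Q_n` leaves
it connected as soon as `2 * A.card + B.card < n`. -/
theorem hypercubeDelete_preconnected {n : ℕ} (S : Set (Fin n → Bool))
    (A B : Finset (Fin n → Bool)) (hA : ∀ v ∈ A, v ∈ S) (hB : ∀ v ∈ B, v ∈ S)
    (hS : ∀ v ∈ S, v ∈ B ∨ ∃ c ∈ A, hammingDist c v ≤ 1) (hcard : 2 * A.card + B.card < n) :
    (hypercubeDelete S).Preconnected := by
  classical
  induction n with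
  | zero => omega
  | succ n ih =>
    by_cases hsep : ∃ u ∈ A ∪ B, ∃ v ∈ A ∪ B, u ≠ v
    · obtain ⟨u, hu, v, hv, huv⟩ := hsep
      obtain ⟨i, hi⟩ := Function.ne_iff.mp huv
      have hne (b : Bool) : ∃ w ∈ A ∪ B, w i = b := by
        by_cases h : u i = b
        · exact ⟨u, hu, h⟩
        · refine ⟨v, hv, ?_⟩
          cases b <;> cases h' : u i <;> cases h'' : v i <;> simp_all
      have hsum (C : Finset (Fin (n + 1) → Bool)) (b : Bool) :
          (C.filter fun v => v i = b).card + (C.filter fun v => v i = !b).card = C.card := by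
        rw [← Finset.card_filter_add_card_filter_not (s := C) (fun v => v i = b)]
        congr 3
        ext v
        cases v i <;> cases b <;> simp
      apply hypercubeDelete_preconnected_of_halves i
      · intro b
        refine ih _ (Finset.univ.filter fun x => i.insertNth b x ∈ A)
          -- Stars centred in the other half leave single vertices here; membership in `S` is
          -- imposed since such a star need not contain the projection of its centre.
          ((Finset.univ.filter fun x => i.insertNth b x ∈ B) ∪
            (Finset.univ.filter fun x => i.insertNth (!b) x ∈ A ∧ i.insertNth b x ∈ S)) ?_ ?_ ?_ ?_
        · intro x hx
          exact hA _ (by simpa using hx)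
        · intro x hx
          simp only [Finset.mem_union, Finset.mem_filter, Finset.mem_univ, true_and] at hx
          rcases hx with hx | hx
          · exact hB _ hx
          · exact hx.2
        · intro x hx
          simp only [Finset.mem_union, Finset.mem_filter, Finset.mem_univ, true_and]
          rcases hS _ hx with h | ⟨c, hc, hd⟩
          · exact Or.inl (Or.inl h)
          · rw [← Fin.insertNth_self_removeNth i c] at hc hd
            rw [hammingDist_insertNth] at hd
            by_cases hcb : c i = b
            · rw [hcb] at hc hd
              exact Or.inr ⟨_, hc, by simpa using hd⟩
            · rw [if_neg hcb] at hd
              have : i.removeNth c = x := hammingDist_lt_one.mp (by omega)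
              rw [this, Bool.eq_not.mpr hcb] at hc
              exact Or.inl (Or.inr ⟨hc, hx⟩)
        · have h1 := card_filter_insertNth_mem A i b
          have h2 := card_filter_insertNth_mem B i b
          have h3 := card_filter_insertNth_mem A i (!b)
          have h4 := Finset.card_le_card (show (Finset.univ.filter fun x : Fin n → Bool =>
              i.insertNth (!b) x ∈ A ∧ i.insertNth b x ∈ S) ⊆
              Finset.univ.filter fun x => i.insertNth (!b) x ∈ A from by
            intro x hx
            simp only [Finset.mem_filter, Finset.mem_univ, true_and] at hx ⊢
            exact hx.1)
          have h5 := Finset.card_union_le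
            (Finset.univ.filter fun x : Fin n → Bool => i.insertNth b x ∈ B)
            (Finset.univ.filter fun x => i.insertNth (!b) x ∈ A ∧ i.insertNth b x ∈ S)
          have h6 := hsum A b
          have h7 := hsum B b
          obtain ⟨w, hw, hwb⟩ := hne (!b)
          have h8 : 0 < (A.filter fun v => v i = !b).card + (B.filter fun v => v i = !b).card := by
            rcases Finset.mem_union.mp hw with hw | hw
            · exact Nat.add_pos_left (Finset.card_pos.mpr ⟨w, Finset.mem_filter.mpr ⟨hw, hwb⟩⟩) _
            · exact Nat.add_pos_right _ (Finset.card_pos.mpr ⟨w, Finset.mem_filter.mpr ⟨hw, hwb⟩⟩)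
          omega
      · by_contra! hbad
        -- If no cross edge survives, balls of at most `n + 1` strings and `B.card` further strings
        -- cover all `2 ^ n` projections. Doubling contradicts `n * (n + 1) < 2 ^ (n + 1)`.
        have hsub : (Finset.univ : Finset (Fin n → Bool)) ⊆
            (A.biUnion fun c => Finset.univ.filter fun x => hammingDist (i.removeNth c) x ≤ 1) ∪
              B.image i.removeNth := by
          intro x _
          obtain ⟨b, hb⟩ := hbad x
          simp only [Finset.mem_union, Finset.mem_biUnion, Finset.mem_filter, Finset.mem_univ,
            true_and, Finset.mem_image]
          rcases hS _ hb with h | ⟨c, hc, hd⟩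
          · exact Or.inr ⟨_, h, by simp⟩
          · rw [← Fin.insertNth_self_removeNth i c, hammingDist_insertNth] at hd
            exact Or.inl ⟨c, hc, by omega⟩
        have h1 := (Finset.card_le_card hsub).trans (Finset.card_union_le _ _)
        have h2 := Finset.card_biUnion_le_card_mul A
          (fun c => Finset.univ.filter fun x => hammingDist (i.removeNth c) x ≤ 1) (n + 1)
          fun c _ => card_hammingDist_le_one _
        have h3 := Finset.card_image_le (s := B) (f := i.removeNth)
        have h4 := mul_succ_lt_two_pow_succ n
        simp only [Finset.card_univ, Fintype.card_pi, Fintype.card_bool, Finset.prod_const,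
          Fintype.card_fin] at h1
        rw [pow_succ] at h4
        have h5 : (2 * A.card + B.card) * (n + 1) ≤ n * (n + 1) :=
          Nat.mul_le_mul_right _ (by omega)
        rcases Nat.eq_zero_or_pos n with rfl | hn
        · have : A.card = 0 := by omega
          have : B.card = 0 := by omega
          simp_all
        · nlinarith
    · push Not at hsep
      by_cases hne : (A ∪ B).Nonempty
      · obtain ⟨c, hc⟩ := hne
        have hcS : c ∈ S := (Finset.mem_union.mp hc).elim (hA c) (hB c)
        refine hypercubeDelete_preconnected_of_subset_ball c (fun v hv => ?_) fun _ _ => hcS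
        rcases hS v hv with h | ⟨c', hc', hd⟩
        · simp [hsep c hc v (Finset.mem_union_right _ h)]
        · rwa [hsep c hc c' (Finset.mem_union_left _ hc')]
      · have hempty : A ∪ B = ∅ := Finset.not_nonempty_iff_eq_empty.mp hne
        rw [Finset.union_eq_empty] at hempty
        have hSe (v) (hv : v ∈ S) : False := by
          rcases hS v hv with h | ⟨c, hc, -⟩ <;> simp_all
        exact hypercubeDelete_preconnected_of_subset_ball (fun _ => false)
          (fun v hv => (hSe v hv).elim) fun v hv => (hSe v hv).elim

/-! ### The lower bound -/

/-- A connected subgraph of a star has a vertex adjacent to all its other vertices. -/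
theorem exists_center_of_connected_subgraph_completeStar {r : ℕ} (T : (completeStar r).Subgraph)
    (hT : T.Connected) : ∃ c : T.verts, ∀ w : T.verts, w ≠ c → T.coe.Adj c w := by
  have hadj (u w : T.verts) (huw : u ≠ w) : ∃ x : T.verts, T.coe.Adj w x := by
    have : Nontrivial T.verts := ⟨u, w, huw⟩
    exact hT.coe.preconnected.exists_adj_of_nontrivial w
  have hstar (j : Fin r) (w x : T.verts) (hw : w.1 = Sum.inr j) (h : T.coe.Adj w x) :
      x.1 = Sum.inl 0 := by
    have h' : (completeStar r).Adj w.1 x.1 := T.adj_sub h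
    rw [hw] at h'
    rcases hx : x.1 with k | k
    · rw [Subsingleton.elim k 0]
    · rw [hx] at h'
      simp [completeStar] at h'
  by_cases h0 : Sum.inl 0 ∈ T.verts
  · refine ⟨⟨_, h0⟩, fun w hw => ?_⟩
    obtain ⟨x, hx⟩ := hadj _ w hw.symm
    rcases hw' : w.1 with k | k
    · exact absurd (Subtype.ext (by rw [hw', Subsingleton.elim k 0])) hw
    · have : x = ⟨_, h0⟩ := Subtype.ext (hstar k w x hw' hx)
      exact this ▸ hx.symm
  -- Leaves are pairwise nonadjacent, so `T` is a single vertex.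
  · obtain ⟨c⟩ := hT.coe.nonempty
    refine ⟨c, fun w hw => ?_⟩
    obtain ⟨x, hx⟩ := hadj c w hw.symm
    rcases hw' : w.1 with k | k
    · exact absurd (by rw [← Subsingleton.elim k 0, ← hw']; exact w.2) h0
    · exact absurd (by rw [← hstar k w x hw' hx]; exact x.2) h0

theorem le_encard_of_isSubstructureCut {r n : ℕ}
    {F : Set (hypercube n).Subgraph} (hF : IsSubstructureCut (hypercube n) (completeStar r) F) :
    (((n + 1) / 2 : ℕ) : ℕ∞) ≤ F.encard := by
  classical
  by_contra! hlt
  obtain ⟨hstar, hdis⟩ := hF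
  have hfin : F.Finite := Set.finite_of_encard_le_coe hlt.le
  have hcenter (H : (hypercube n).Subgraph) (hH : H ∈ F) :
      ∃ c ∈ H.verts, ∀ v ∈ H.verts, hammingDist c v ≤ 1 := by
    obtain ⟨T, hT, ⟨e⟩⟩ := hstar H hH
    obtain ⟨c, hc⟩ := exists_center_of_connected_subgraph_completeStar T hT
    refine ⟨(e.symm c).1, (e.symm c).2, fun v hv => ?_⟩
    by_cases h : e ⟨v, hv⟩ = c
    · have : e.symm c = ⟨v, hv⟩ := by simp [← h]
      simp [this]
    · have h1 := e.symm.map_adj_iff.mpr (hc _ h)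
      rw [e.symm_apply_apply] at h1
      exact le_of_eq (H.adj_sub h1)
  choose! c hc hball using hcenter
  refine hdis (hypercubeDelete_preconnected (⋃ H ∈ F, H.verts) (hfin.toFinset.image c) ∅ ?_
    (by simp) ?_ ?_)
  · intro v hv
    obtain ⟨H, hH, rfl⟩ := Finset.mem_image.mp hv
    exact Set.mem_biUnion (hfin.mem_toFinset.mp hH) (hc H (hfin.mem_toFinset.mp hH))
  · intro v hv
    obtain ⟨H, hH, hv⟩ := Set.mem_iUnion₂.mp hv
    exact Or.inr ⟨c H, Finset.mem_image_of_mem _ (hfin.mem_toFinset.mpr hH), hball H hH v hv⟩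
  · have h1 := Finset.card_image_le (s := hfin.toFinset) (f := c)
    rw [hfin.encard_eq_coe_toFinset_card, Nat.cast_lt] at hlt
    simp only [Finset.card_empty]
    omega

theorem IsStructureCut.isSubstructureCut {V W : Type*} {G : SimpleGraph V} {T : SimpleGraph W}
    (hT : T.Connected) {F : Set G.Subgraph} (hF : IsStructureCut G T F) :
    IsSubstructureCut G T F := by
  refine ⟨fun H hH => ?_, hF.2⟩
  obtain ⟨e⟩ := hF.1 H hH
  refine ⟨⊤, ?_, ⟨SimpleGraph.Subgraph.topIso.symm.comp e⟩⟩
  exact ⟨(SimpleGraph.Iso.connected_iff SimpleGraph.Subgraph.topIso).mpr hT⟩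

theorem completeStar_connected (r : ℕ) : (completeStar r).Connected := by
  have h (x : Fin 1 ⊕ Fin r) : (completeStar r).Reachable (Sum.inl 0) x := by
    rcases x with k | k
    · rw [Subsingleton.elim k 0]
    · exact SimpleGraph.Adj.reachable (by simp [completeStar])
  exact { preconnected := fun u v => (h u).symm.trans (h v), nonempty := ⟨Sum.inl 0⟩ }

/-! ### The upper bound: a cut isolating the zero string -/

/-- The star in `Q_n` with centre `c` and leaves `flipAt c (g j)`. -/
def starCopy {n r : ℕ} (c : Fin n → Bool) (g : Fin r ↪ Fin n) :
    SimpleGraph.Copy (completeStar r) (hypercube n) where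
  toHom :=
    { toFun := Sum.elim (fun _ => c) fun j => flipAt c (g j)
      map_rel' := by
        rintro (a | a) (b | b) h
        · simp [completeStar] at h
        · exact hypercube_adj_flipAt c (g b)
        · exact (hypercube_adj_flipAt c (g a)).symm
        · simp [completeStar] at h }
  injective' := by
    rintro (a | a) (b | b) h
    · rw [Subsingleton.elim a b]
    · exact absurd h (hypercube_adj_flipAt c (g b)).ne
    · exact absurd h (hypercube_adj_flipAt c (g a)).ne'
    · exact congrArg Sum.inr (g.injective (flipAt_injective c h))

theorem mem_verts_starCopy {n r : ℕ} {c : Fin n → Bool} {g : Fin r ↪ Fin n} {v : Fin n → Bool} :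
    v ∈ (starCopy c g).toSubgraph.verts ↔ v = c ∨ ∃ j, v = flipAt c (g j) := by
  simp only [SimpleGraph.Subgraph.map_verts, SimpleGraph.Subgraph.verts_top, Set.image_univ,
    Set.mem_range, Sum.exists]
  constructor
  · rintro (⟨a, h⟩ | ⟨a, h⟩)
    · exact Or.inl h.symm
    · exact Or.inr ⟨a, h.symm⟩
  · rintro (h | ⟨a, h⟩)
    · exact Or.inl ⟨0, h.symm⟩
    · exact Or.inr ⟨a, h.symm⟩

theorem exists_embedding_pair_subset_range {n r : ℕ} (hr : 2 ≤ r) (hrn : r ≤ n) (p q : Fin n) :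
    ∃ g : Fin r ↪ Fin n, p ∈ Set.range g ∧ q ∈ Set.range g := by
  obtain ⟨s, hs, -, hcard⟩ := Finset.exists_subsuperset_card_eq
    (Finset.subset_univ ({p, q} : Finset (Fin n))) (Finset.card_le_two.trans hr) (by simpa using hrn)
  refine ⟨(s.orderEmbOfFin hcard).toEmbedding, ?_, ?_⟩ <;>
  · change _ ∈ Set.range (s.orderEmbOfFin hcard)
    rw [Finset.range_orderEmbOfFin]
    exact hs (by simp)

theorem exists_isStructureCut_encard_le {r n : ℕ} (hr : 2 ≤ r) (hrn : r ≤ n) (hn : 4 ≤ n) :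
    ∃ F : Set (hypercube n).Subgraph, IsStructureCut (hypercube n) (completeStar r) F ∧
      F.encard ≤ (((n + 1) / 2 : ℕ) : ℕ∞) := by
  let p : Fin ((n + 1) / 2) → Fin n := fun k => ⟨2 * k, by omega⟩
  -- For odd `n` the last coordinate has no partner and is paired with 0.
  let q : Fin ((n + 1) / 2) → Fin n := fun k =>
    if h : 2 * k.1 + 1 < n then ⟨2 * k + 1, h⟩ else ⟨0, by omega⟩
  have hpq (k) : p k ≠ q k := by
    simp only [p, q, ne_eq, Fin.ext_iff]
    split_ifs
    · simp
    · simp only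
      omega
  have hcover (i : Fin n) : ∃ k, i = p k ∨ i = q k := by
    refine ⟨⟨i / 2, by omega⟩, ?_⟩
    simp only [p, q, Fin.ext_iff]
    rcases Nat.mod_two_eq_zero_or_one i with h | h
    · left; omega
    · right
      rw [dif_pos (by omega)]
      simp only
      omega
  choose g hgp hgq using fun k => exists_embedding_pair_subset_range hr hrn (p k) (q k)
  let z : Fin n → Bool := fun _ => false
  let c : Fin ((n + 1) / 2) → Fin n → Bool := fun k => flipAt (flipAt z (p k)) (q k)
  have hcp (k) : flipAt (c k) (p k) = flipAt z (q k) := by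
    simp only [c]
    rw [flipAt_comm z (hpq k), flipAt_flipAt]
  have hcq (k) : flipAt (c k) (q k) = flipAt z (p k) := flipAt_flipAt _ _
  have hcp1 (k) : c k (p k) = true := by
    simp [c, flipAt_of_ne _ (hpq k), z]
  have hcq1 (k) : c k (q k) = true := by
    simp [c, flipAt_of_ne _ (hpq k).symm, z]
  let F : Set (hypercube n).Subgraph := Set.range fun k => (starCopy (c k) (g k)).toSubgraph
  have hmem (v) : v ∈ ⋃ H ∈ F, H.verts ↔ ∃ k, v = c k ∨ ∃ j, v = flipAt (c k) (g k j) := by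
    simp only [F, Set.mem_iUnion, exists_prop, Set.exists_range_iff, mem_verts_starCopy]
  have hz : z ∉ ⋃ H ∈ F, H.verts := by
    rw [hmem]
    rintro ⟨k, h | ⟨j, h⟩⟩
    · have := congrFun h (p k)
      simp [hcp1, z] at this
    · by_cases hj : p k = g k j
      · have := congrFun h (q k)
        rw [flipAt_of_ne _ (hj ▸ (hpq k).symm), hcq1] at this
        simp [z] at this
      · have := congrFun h (p k)
        rw [flipAt_of_ne _ hj, hcp1] at this
        simp [z] at this
  have ho : (fun _ => true) ∉ ⋃ H ∈ F, H.verts := by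
    rw [hmem]
    -- Deleted strings have at most three ones, so for 4 ≤ n the all-ones string survives.
    have hthird (a b d : Fin n) : ∃ i, i ≠ a ∧ i ≠ b ∧ i ≠ d := by
      obtain ⟨i, -, hi⟩ := Finset.exists_mem_notMem_of_card_lt_card
        (s := ({a, b, d} : Finset (Fin n))) (t := Finset.univ)
        (Finset.card_le_three.trans_lt (by simpa using by omega))
      simp only [Finset.mem_insert, Finset.mem_singleton, not_or] at hi
      exact ⟨i, hi⟩
    rintro ⟨k, h | ⟨j, h⟩⟩
    · obtain ⟨i, h1, h2, -⟩ := hthird (p k) (q k) (q k)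
      have := congrFun h i
      simp [c, flipAt_of_ne _ h1, flipAt_of_ne _ h2, z] at this
    · obtain ⟨i, h1, h2, h3⟩ := hthird (p k) (q k) (g k j)
      have := congrFun h i
      simp [c, flipAt_of_ne _ h1, flipAt_of_ne _ h2, flipAt_of_ne _ h3, z] at this
  refine ⟨F, ⟨?_, fun hpre => ?_⟩, ?_⟩
  · rintro _ ⟨k, rfl⟩
    exact ⟨(starCopy (c k) (g k)).isoToSubgraph.symm⟩
  · have : Nontrivial {v // v ∉ ⋃ H ∈ F, H.verts} :=
      ⟨⟨z, hz⟩, ⟨_, ho⟩, fun h => by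
        have := congrFun (congrArg Subtype.val h) ⟨0, by omega⟩
        simp [z] at this⟩
    obtain ⟨⟨w, hw⟩, hadj⟩ := hpre.exists_adj_of_nontrivial ⟨z, hz⟩
    obtain ⟨i, rfl⟩ := hypercube_adj_iff_exists_flipAt.mp (show (hypercube n).Adj z w from hadj)
    obtain ⟨k, hk⟩ := hcover i
    refine hw ((hmem _).mpr ⟨k, Or.inr ?_⟩)
    rcases hk with rfl | rfl
    · obtain ⟨j, hj⟩ := hgq k
      exact ⟨j, by rw [hj, hcq]⟩
    · obtain ⟨j, hj⟩ := hgp k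
      exact ⟨j, by rw [hj, hcp]⟩
  · calc F.encard = ((fun k => (starCopy (c k) (g k)).toSubgraph) '' Set.univ).encard := by
          rw [Set.image_univ]
      _ ≤ (Set.univ : Set (Fin ((n + 1) / 2))).encard := Set.encard_image_le _ _
      _ = _ := by simp [Set.encard_univ]

/-! ### The threshold and the conclusion -/

/-- The linear term of the maximum is at least r for small r, the first quadratic one for large r,
and these ranges overlap. -/
theorem le_of_starThreshold_lt {r n : ℕ} (hn : starThreshold r < (n : ℚ)) : r ≤ n ∧ 4 ≤ n := by
  unfold starThreshold at hn
  have hr0 : (0 : ℚ) ≤ r := Nat.cast_nonneg r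
  split_ifs at hn
  · obtain ⟨h1, h2⟩ := max_lt_iff.mp hn
    refine ⟨?_, ?_⟩
    · have : (r : ℚ) ≤ n := by
        by_contra! h
        nlinarith
      exact_mod_cast this
    · have : (3 : ℚ) < n := by linarith
      exact_mod_cast this
  · obtain ⟨h1, h2⟩ := max_lt_iff.mp hn
    obtain ⟨h2, -⟩ := max_lt_iff.mp h2
    refine ⟨?_, ?_⟩
    · have : (r : ℚ) ≤ n := by
        by_contra! h
        nlinarith
      exact_mod_cast this
    · have : (3 : ℚ) < n := by linarith
      exact_mod_cast this

theorem ceil_half_eq (n : ℕ) : ⌈(n : ℚ) / 2⌉₊ = (n + 1) / 2 := by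
  apply le_antisymm
  · rw [Nat.ceil_le, div_le_iff₀ (by norm_num)]
    exact_mod_cast (by omega : n ≤ (n + 1) / 2 * 2)
  · have h := Nat.le_ceil ((n : ℚ) / 2)
    rw [div_le_iff₀ (by norm_num)] at h
    have : n ≤ ⌈(n : ℚ) / 2⌉₊ * 2 := by exact_mod_cast h
    omega

theorem theorem3p13 (r n : ℕ) (hr : 2 ≤ r) (hn : starThreshold r < (n : ℚ)) :
    structureConnectivity (hypercube n) (completeStar r) = ((⌈(n : ℚ) / 2⌉₊ : ℕ) : ℕ∞) ∧
      substructureConnectivity (hypercube n) (completeStar r) = ((⌈(n : ℚ) / 2⌉₊ : ℕ) : ℕ∞) := by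
  obtain ⟨hrn, hn4⟩ := le_of_starThreshold_lt hn
  rw [ceil_half_eq]
  obtain ⟨F, hF, hcard⟩ := exists_isStructureCut_encard_le hr hrn hn4
  have hsub {F : Set (hypercube n).Subgraph}
      (hF : IsStructureCut (hypercube n) (completeStar r) F) :
      IsSubstructureCut (hypercube n) (completeStar r) F :=
    hF.isSubstructureCut (completeStar_connected r)
  refine ⟨le_antisymm (le_trans (sInf_le ⟨F, hF, rfl⟩) hcard) (le_sInf ?_),
    le_antisymm (le_trans (sInf_le ⟨F, hsub hF, rfl⟩) hcard) (le_sInf ?_)⟩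
  · rintro _ ⟨F', hF', rfl⟩
    exact le_encard_of_isSubstructureCut (hsub hF')
  · rintro _ ⟨F', hF', rfl⟩
    exact le_encard_of_isSubstructureCut hF'
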